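/- There are universal constants $C,C'>0$ such that the following holds. Setting. Let $d\ge 1$, let $\phi:\mathbb{R}^d\to\mathbb{R}$ be convex quadratic with Hessian $A$, i.e. $\phi(y)=\phi(x)+\langle\nabla\phi(x),y-x\rangle+\tfrac12 (y-x)^\top A(y-x)$ with $A$ symmetric positive semidefinite, and let $\phi$ be $\mu$-strongly convex for some $\mu>0$, with minimizer $x^*$. Let $f:\mathbb{R}^d\to\mathbb{R}$ be a (measurable) noisy version of $\phi$ with $|f(x)-\phi(x)|\le\sigma$ for all $x$. Let $(H_t)_{t\ge0}$ be symmetric positive definite matrices and $\rho_t>0$ with $\rho_tH_t\preceq A$. Let $x_0\in\mathbb{R}^d$, $\alpha>0$, $k\ge1$, $0<\epsilon\le\frac12$, $\delta\in(0,1)$, $c_0>0$ and $\ell\in\mathbb{N}$. Write $\|\cdot\|_2$ for the spectral norm, $\|\cdot\|_F$ for the Frobenius norm, $\Delta=\phi(x_0)-\phi(x^*)$ and $\log^+=\max(0,\log)$. Sketches. A random matrix $S\in\mathbb{R}^{d\times \ell}$ is an oblivious $(\gamma,k,\delta')$-sketching matrix if for every fixed $B\in\mathbb{R}^{d\times d}$,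 with probability at least $1-\delta'$, $\|B^\top SS^\top B-B^\top B\|_2\le\gamma\left(\|B\|_2^2+\|B\|_F^2/k\right)$. Algorithm. For $t=0,\dots,T-1$ draw, independently over $t$, an oblivious $(\frac14,k,\frac{\delta}{T})$-sketching matrix $S_t\in\mathbb{R}^{d\times\ell}$ with columns $s_t^{(1)},\dots,s_t^{(\ell)}$, query $f$ at the $2\ell$ points $x_t\pm\alpha H_t^{-1/2}s_t^{(i)}$, and set $$x_{t+1}=x_t-\eta_t\sum_{i=1}^{\ell}\frac{f(x_t+\alpha H_t^{-1/2}s_t^{(i)})-f(x_t-\alpha H_t^{-1/2}s_t^{(i)})}{2\alpha}\,H_t^{-1/2}s_t^{(i)},\qquad \eta_t=\Big(5\|H_t^{-1/2}AH_t^{-1/2}\|_2+\frac{\mathrm{tr}(H_t^{-1}A)}{k}\Big)^{-1}.$$ For $T\ge1$ put $$N(T)=C\,(1+\log^+\Delta)\,\max_{0\le t<T}\Big\{\rho_t^{-1}\Big(\|H_t^{-1/2}AH_t^{-1/2}\|_2+\frac{\mathrm{tr}(H_t^{-1}A)}{k}\Big)\Big\}\log\frac1\epsilon .$$ Claims. (1)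 If $\rho_t^{-1}\big(\|H_t^{-1/2}AH_t^{-1/2}\|_2+\mathrm{tr}(H_t^{-1}A)/k\big)$ is bounded over $t\ge0$, there is an integer $T\ge1$ with $N(T)\le T\le 2N(T)$. (2) For every integer $T\ge1$ with $k>\log\frac{T}{\delta}$, $\ell\le c_0\left(k+\log\frac T\delta\right)$ and $T\ge N(T)$, the output $x_T$ of the algorithm satisfies, with probability at least $1-\delta$, $$\phi(x_T)-\phi(x^*)\le\epsilon+\frac{3\ell\sigma^2}{\rho\alpha^2},\qquad \rho=\min_{0\le t<T}\rho_t .$$ (3) If moreover $T\le 2N(T)$, the total number of queries of $f$ made by the algorithm is always at most $$C'(1+c_0)(1+\log^+\Delta)\,\max_{0\le t<T}\Big\{\rho_t^{-1}\Big(\ell\,\|H_t^{-1/2}AH_t^{-1/2}\|_2+\mathrm{tr}(H_t^{-1}A)\Big)\Big\}\log\frac1\epsilon .$$ That is, $T=O\big(\max_t\rho_t^{-1}(\|H_t^{-1/2}AH_t^{-1/2}\|_2+\mathrm{tr}(H_t^{-1}A)/k)\log\frac1\epsilon\big)$ iterations suffice, with query complexity $O\big(\max_t\rho_t^{-1}(\ell\|H_t^{-1/2}AH_t^{-1/2}\|_2+\mathrm{tr}(H_t^{-1}A))\log\frac1\epsilon\big)$,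 where the constants depend only on $c_0$ and the initial gap $\Delta$. -/

import Mathlib

open MeasureTheory ProbabilityTheory

noncomputable section

namespace ZerothOrder

/-- Real matrices carry the product (Borel) sigma-algebra of their entries. -/
instance instMeasurableSpaceMatrix {m n : Type*} : MeasurableSpace (Matrix m n ℝ) :=
  inferInstanceAs (MeasurableSpace (m → n → ℝ))

/-! ### Matrix norms and roots -/

open scoped Matrix.Norms.L2Operator in
/-- The spectral norm of a real matrix (operator norm for the Euclidean norms). -/
def specNorm {m n : ℕ} (B : Matrix (Fin m) (Fin n) ℝ) : ℝ := ‖B‖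

/-- The square of the Frobenius norm. -/
def frobSq {m n : ℕ} (B : Matrix (Fin m) (Fin n) ℝ) : ℝ := ∑ i, ∑ j, B i j ^ 2

open scoped MatrixOrder in
/-- `H ^ (-1/2)` for a positive definite matrix `H`: the inverse of its positive square root. -/
def invSqrt {d : ℕ} (H : Matrix (Fin d) (Fin d) ℝ) : Matrix (Fin d) (Fin d) ℝ :=
  (CFC.sqrt H)⁻¹

/-- The preconditioned Hessian `H ^ (-1/2) * A * H ^ (-1/2)`. -/
def precond {d : ℕ} (A H : Matrix (Fin d) (Fin d) ℝ) : Matrix (Fin d) (Fin d) ℝ :=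
  invSqrt H * A * invSqrt H

/-! ### The objective function -/

/-- `φ` is convex quadratic with Hessian `A`:
`φ y = φ x + ⟨∇φ x, y - x⟩ + (1/2) ‖y - x‖_A ^ 2` for all `x`, `y`, with `A` symmetric positive
semidefinite and `‖u‖_A ^ 2 = ⟨u, A u⟩`. (An upper bound `A ≼ L I` always holds for some `L`.) -/
def IsConvexQuadratic {d : ℕ} (φ : EuclideanSpace ℝ (Fin d) → ℝ)
    (A : Matrix (Fin d) (Fin d) ℝ) : Prop :=
  A.PosSemidef ∧ ∀ x y : EuclideanSpace ℝ (Fin d),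
    φ y = φ x + inner ℝ (gradient φ x) (y - x)
      + 1 / 2 * inner ℝ (y - x) (Matrix.toEuclideanLin A (y - x))

/-- `φ` is `μ`-strongly convex, in gradient form. -/
def IsStronglyConvex {d : ℕ} (φ : EuclideanSpace ℝ (Fin d) → ℝ) (μ : ℝ) : Prop :=
  ∀ x y : EuclideanSpace ℝ (Fin d),
    φ x + inner ℝ (gradient φ x) (y - x) + μ / 2 * ‖y - x‖ ^ 2 ≤ φ y

/-! ### Oblivious sketching matrices -/

/-- The random matrix `S` is an oblivious `(γ, k, δ)`-sketching matrix for matrix product: for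
every fixed `B`, the approximate matrix product bound holds with probability at least `1 - δ`. -/
def IsObliviousSketch {Ω : Type*} [MeasurableSpace Ω] (P : Measure Ω) {d l : ℕ}
    (γ k δ : ℝ) (S : Ω → Matrix (Fin d) (Fin l) ℝ) : Prop :=
  Measurable S ∧ ∀ B : Matrix (Fin d) (Fin d) ℝ,
    1 - δ ≤ P.real {ω |
      specNorm (B.transpose * S ω * (S ω).transpose * B - B.transpose * B)
        ≤ γ * (specNorm B ^ 2 + frobSq B / k)}

/-! ### Algorithms with access to a zeroth-order oracle -/

/-- A procedure which returns a value in `β` and can learn about the objective only by asking for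
function values at points of `E`. -/
inductive ZOProg (E β : Type) : Type
  | ret (b : β) : ZOProg E β
  | query (x : E) (next : ℝ → ZOProg E β) : ZOProg E β

namespace ZOProg

variable {E β β' : Type}

/-- Sequential composition. -/
def bind : ZOProg E β → (β → ZOProg E β') → ZOProg E β'
  | ret b, g => g b
  | query x next, g => query x (fun v => bind (next v) g)

/-- The value returned when queries are answered by `f`. -/
def output (f : E → ℝ) : ZOProg E β → β
  | ret b => b
  | query x next => output f (next (f x))

/-- The number of queries made when queries are answered by `f`. -/
def queries (f : E → ℝ) : ZOProg E β → ℕ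
  | ret _ => 0
  | query x next => queries f (next (f x)) + 1

end ZOProg

/-- The symmetric finite-difference estimate at `x` along a list of directions: it returns
`∑ u, ((f (x + α u) - f (x - α u)) / (2 α)) u`. -/
def estimate {d : ℕ} (α : ℝ) (x : EuclideanSpace ℝ (Fin d)) :
    List (EuclideanSpace ℝ (Fin d)) → ZOProg (EuclideanSpace ℝ (Fin d)) (EuclideanSpace ℝ (Fin d))
  | [] => .ret 0
  | u :: us =>
    .query (x + α • u) fun a =>
    .query (x - α • u) fun b =>
    (estimate α x us).bind fun g => .ret (((a - b) / (2 * α)) • u + g)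

/-- The search directions `H ^ (-1/2) s⁽¹⁾, …, H ^ (-1/2) s⁽ˡ⁾`, with `s⁽ⁱ⁾` the columns of `S`. -/
def directions {d l : ℕ} (H : Matrix (Fin d) (Fin d) ℝ) (S : Matrix (Fin d) (Fin l) ℝ) :
    List (EuclideanSpace ℝ (Fin d)) :=
  List.ofFn fun i : Fin l => WithLp.toLp 2 ((invSqrt H).mulVec fun j => S j i)

/-- The first `T` iterations `x_{t+1} = x_t - η_t g_t` of the Hessian-aware zeroth-order
algorithm, with `g_t` the estimate at `x_t` along the directions given by `H_t` and `S_t`;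
it returns `x_T`. -/
def hessianAware {d l : ℕ} (α : ℝ) (η : ℕ → ℝ) (H : ℕ → Matrix (Fin d) (Fin d) ℝ)
    (S : ℕ → Matrix (Fin d) (Fin l) ℝ) (x₀ : EuclideanSpace ℝ (Fin d)) :
    ℕ → ZOProg (EuclideanSpace ℝ (Fin d)) (EuclideanSpace ℝ (Fin d))
  | 0 => .ret x₀
  | t + 1 =>
    (hessianAware α η H S x₀ t).bind fun x =>
    (estimate α x (directions (H t) (S t))).bind fun g => .ret (x - η t • g)

/-! ### Quantities in the complexity bounds -/

/-- The step size `η_t = (5 ‖H^{-1/2} A H^{-1/2}‖₂ + tr(H⁻¹ A) / k)⁻¹` for `H = H_t`. -/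
def stepSize {d : ℕ} (A H : Matrix (Fin d) (Fin d) ℝ) (k : ℝ) : ℝ :=
  (5 * specNorm (precond A H) + (H⁻¹ * A).trace / k)⁻¹

/-- `ρ⁻¹ (‖H^{-1/2} A H^{-1/2}‖₂ + tr(H⁻¹ A) / k)`. -/
def iterTerm {d : ℕ} (A H : Matrix (Fin d) (Fin d) ℝ) (ρ k : ℝ) : ℝ :=
  ρ⁻¹ * (specNorm (precond A H) + (H⁻¹ * A).trace / k)

/-- `ρ⁻¹ (‖H^{-1/2} A H^{-1/2}‖₂ · l + tr(H⁻¹ A))`. -/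
def queryTerm {d : ℕ} (A H : Matrix (Fin d) (Fin d) ℝ) (ρ : ℝ) (l : ℕ) : ℝ :=
  ρ⁻¹ * (specNorm (precond A H) * l + (H⁻¹ * A).trace)

/-- `N = C (1 + log⁺ Δ) · max_{t < T} ρ_t⁻¹ (‖H_t^{-1/2} A H_t^{-1/2}‖₂ + tr(H_t⁻¹ A) / k)
· log (1 / ε)`, the order of the number of iterations; `Δ` is the initial optimality gap. -/
def iterBound {d : ℕ} (C Δ : ℝ) (A : Matrix (Fin d) (Fin d) ℝ)
    (H : ℕ → Matrix (Fin d) (Fin d) ℝ) (ρ : ℕ → ℝ) (k ε : ℝ) (T : ℕ) : ℝ :=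
  C * (1 + Real.posLog Δ) * (⨆ t : Fin T, iterTerm A (H t) (ρ t) k) * Real.log (1 / ε)

/-- `C (1 + log⁺ Δ) · max_{t < T} ρ_t⁻¹ (‖H_t^{-1/2} A H_t^{-1/2}‖₂ · l + tr(H_t⁻¹ A))
· log (1 / ε)`, the order of the number of queries. -/
def queryBound {d : ℕ} (C Δ : ℝ) (A : Matrix (Fin d) (Fin d) ℝ)
    (H : ℕ → Matrix (Fin d) (Fin d) ℝ) (ρ : ℕ → ℝ) (l : ℕ) (ε : ℝ) (T : ℕ) : ℝ :=
  C * (1 + Real.posLog Δ) * (⨆ t : Fin T, queryTerm A (H t) (ρ t) l) * Real.log (1 / ε)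

end ZerothOrder

end

/-!
Write `y = x - xstar`, `P = H ^ (-1/2)`, `M = P A P`, `v = P A y = P ∇φ x` and
`L = ‖M‖ + tr M / k`. A minimizer kills the linear term, so `φ x - φ xstar = (1/2) ⟨y, A y⟩`, and the
difference quotients of `φ` along the columns of `P S` are exactly the entries of `q = Sᵀ v`; those
of `f` are `q + n` with `|n|² ≤ l σ² / α²`.

A step turns `y` into `y - η P S (q + n)`. If `Sᵀ M S ≼ η⁻¹ I`, then twice the gap changes by at most
`-2 η ⟨q + n, q⟩ + η |q + n|² = η (|n|² - |q|²)`. If moreover `|q|² ≥ |v|² / 4`, then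
`|q|² ≥ (ρ / 4) ⟨y, A y⟩`, because `ρ H ≼ A` means `ρ I ≼ M` and `v` is `M` applied to `P⁻¹ y`. Hence
the gap contracts by `1 - η ρ / 4` up to noise (`IsConvexQuadratic.step_gap_le`), with fixed point
at most `2 l σ² / (ρ α²)`.

Both requirements on `S` have to follow from one sketching event, since each iteration may fail only
with probability `δ / T`. They do, for a test matrix adapted to the current point, with
`B Bᵀ = M + L v vᵀ / |v|²` (`exists_test_matrix`). The current point is random, but it is independent
of the current sketch, so conditioning on it and a union bound give probability `1 - δ`
(`one_sub_le_measureReal_orbit`). It remains to add up the contraction rates, which are at least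
`1 / (20 max_t iterTerm)` (`le_pow_mul_add_of_contraction`, `pow_mul_le_of_le`).

Every run makes `2 l T` queries, and `log (T / δ) < k` gives `l ≤ 2 c₀ k`, which turns
`l * iterTerm` into a multiple of `queryTerm` (`queries_le_queryBound`).
-/

namespace ZerothOrder

/-! ### Spectral norm, factorization and the test matrix -/

section LinearAlgebra

open Matrix

variable {m n d : ℕ}

open scoped Matrix.Norms.L2Operator in
theorem specNorm_nonneg (B : Matrix (Fin m) (Fin n) ℝ) : 0 ≤ specNorm B := by
  unfold specNorm
  exact norm_nonneg B

theorem real_dotProduct_self_nonneg (x : Fin n → ℝ) : 0 ≤ x ⬝ᵥ x := by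
  simpa using dotProduct_star_self_nonneg x

theorem dotProduct_sq_le (x y : Fin n → ℝ) : (x ⬝ᵥ y) ^ 2 ≤ (x ⬝ᵥ x) * (y ⬝ᵥ y) := by
  simp only [dotProduct, ← pow_two]
  exact Finset.sum_mul_sq_le_sq_mul_sq _ _ _

open scoped Matrix.Norms.L2Operator in
/-- The spectral norm bounds the length of `E *ᵥ x`. -/
theorem mulVec_dotProduct_self_le (E : Matrix (Fin m) (Fin n) ℝ) (x : Fin n → ℝ) :
    (E *ᵥ x) ⬝ᵥ (E *ᵥ x) ≤ specNorm E ^ 2 * (x ⬝ᵥ x) := by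
  have h := Matrix.l2_opNorm_mulVec E (WithLp.toLp 2 x)
  have h2 := pow_le_pow_left₀ (norm_nonneg _) h 2
  rw [mul_pow, EuclideanSpace.norm_sq_eq, EuclideanSpace.norm_sq_eq] at h2
  simpa [dotProduct, ← pow_two, specNorm] using h2

theorem dotProduct_mulVec_le_specNorm (E : Matrix (Fin n) (Fin n) ℝ) (x : Fin n → ℝ) :
    |x ⬝ᵥ E *ᵥ x| ≤ specNorm E * (x ⬝ᵥ x) := by
  have h0 := real_dotProduct_self_nonneg x
  apply abs_le_of_sq_le_sq _ (mul_nonneg (specNorm_nonneg E) h0)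
  calc (x ⬝ᵥ E *ᵥ x) ^ 2 ≤ (x ⬝ᵥ x) * ((E *ᵥ x) ⬝ᵥ (E *ᵥ x)) := dotProduct_sq_le _ _
    _ ≤ (x ⬝ᵥ x) * (specNorm E ^ 2 * (x ⬝ᵥ x)) := by
        gcongr; exact mulVec_dotProduct_self_le E x
    _ = _ := by ring

open scoped Matrix.Norms.L2Operator in
theorem specNorm_sq (B : Matrix (Fin n) (Fin n) ℝ) : specNorm B ^ 2 = specNorm (B * Bᵀ) := by
  have h := Matrix.l2_opNorm_conjTranspose_mul_self Bᴴ
  rw [conjTranspose_conjTranspose, Matrix.l2_opNorm_conjTranspose] at h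
  simp only [specNorm, pow_two, ← h, conjTranspose_eq_transpose_of_trivial]

open scoped Matrix.Norms.L2Operator in
theorem specNorm_add_le (B E : Matrix (Fin m) (Fin n) ℝ) :
    specNorm (B + E) ≤ specNorm B + specNorm E := norm_add_le B E

open scoped Matrix.Norms.L2Operator in
theorem specNorm_smul_vecMulVec_le {c : ℝ} (hc : 0 ≤ c) (v : Fin n → ℝ) :
    specNorm (c • vecMulVec v v) ≤ c * (v ⬝ᵥ v) := by
  have hv := real_dotProduct_self_nonneg v
  unfold specNorm
  rw [Matrix.l2_opNorm_def]
  refine ContinuousLinearMap.opNorm_le_bound _ (mul_nonneg hc hv) fun x => ?_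
  refine abs_le_of_sq_le_sq' ?_ (by positivity) |>.2
  rw [mul_pow, EuclideanSpace.norm_sq_eq, EuclideanSpace.norm_sq_eq]
  have := dotProduct_sq_le v x.ofLp
  have e : ∑ i, ‖((toEuclideanLin (𝕜 := ℝ) (m := Fin n) (n := Fin n)).trans
      LinearMap.toContinuousLinearMap (c • vecMulVec v v) x).ofLp i‖ ^ 2
      = c ^ 2 * (v ⬝ᵥ v) * (v ⬝ᵥ x.ofLp) ^ 2 := by
    simp [toLpLin_apply, vecMulVec_mulVec, mul_pow]
    simp only [dotProduct, Finset.mul_sum, Finset.sum_mul, ← pow_two]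
    refine Finset.sum_congr rfl fun i _ => by ring
  rw [e]
  have e2 : ∑ i, ‖x.ofLp i‖ ^ 2 = x.ofLp ⬝ᵥ x.ofLp := by simp [dotProduct, pow_two]
  rw [e2]
  calc c ^ 2 * (v ⬝ᵥ v) * (v ⬝ᵥ x.ofLp) ^ 2
      ≤ c ^ 2 * (v ⬝ᵥ v) * ((v ⬝ᵥ v) * (x.ofLp ⬝ᵥ x.ofLp)) := by gcongr
    _ = _ := by ring

theorem frobSq_eq_trace (B : Matrix (Fin m) (Fin n) ℝ) : frobSq B = (B * Bᵀ).trace := by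
  simp [frobSq, trace, mul_apply, pow_two]

theorem dotProduct_mulVec_transpose (B : Matrix (Fin m) (Fin n) ℝ) (x : Fin m → ℝ)
    (y : Fin n → ℝ) : x ⬝ᵥ B *ᵥ y = (Bᵀ *ᵥ x) ⬝ᵥ y := by
  rw [dotProduct_mulVec, mulVec_transpose]

theorem dotProduct_mul_transpose_mulVec (N : Matrix (Fin n) (Fin m) ℝ) (z : Fin n → ℝ) :
    z ⬝ᵥ (N * Nᵀ) *ᵥ z = (Nᵀ *ᵥ z) ⬝ᵥ (Nᵀ *ᵥ z) := by
  rw [← mulVec_mulVec, dotProduct_mulVec_transpose]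

/-- Douglas factorization for one vector: if `a aᵀ ≼ c B Bᵀ` with `B` invertible, then `a` is the
image under `B` of a vector of squared length at most `c`. -/
theorem exists_mulVec_eq_of_sq_le {B : Matrix (Fin n) (Fin n) ℝ} (hB : IsUnit B)
    {a : Fin n → ℝ} {c : ℝ} (hc : 0 ≤ c)
    (ha : ∀ z, (a ⬝ᵥ z) ^ 2 ≤ c * ((Bᵀ *ᵥ z) ⬝ᵥ (Bᵀ *ᵥ z))) :
    ∃ w, B *ᵥ w = a ∧ w ⬝ᵥ w ≤ c := by
  obtain ⟨w, hw⟩ := (mulVec_surjective_iff_isUnit.2 hB) a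
  obtain ⟨z, hz⟩ := (mulVec_surjective_iff_isUnit.2 ((isUnit_transpose B).2 hB)) w
  refine ⟨w, hw, ?_⟩
  -- `|w|² = ⟨w, Bᵀ z⟩ = ⟨a, z⟩`, hence `|w|⁴ ≤ c |w|²`
  have h1 : a ⬝ᵥ z = w ⬝ᵥ w := by
    rw [dotProduct_comm, ← hw, dotProduct_mulVec_transpose, hz]
  have h2 := ha z
  rw [hz, h1] at h2
  by_contra! hlt
  nlinarith

open scoped MatrixOrder in
theorem exists_mul_transpose {M : Matrix (Fin n) (Fin n) ℝ} (hM : M.PosSemidef) :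
    ∃ N : Matrix (Fin n) (Fin n) ℝ, M = N * Nᵀ := by
  refine ⟨CFC.sqrt M, ?_⟩
  have h := (CFC.sqrt_nonneg M).posSemidef.1
  rw [IsHermitian, conjTranspose_eq_transpose_of_trivial] at h
  rw [h, CFC.sqrt_mul_sqrt_self M hM.nonneg]

/-- One test matrix serves two purposes. With `L = ‖M‖ + tr M / k`, take `B Bᵀ = M + L v vᵀ / |v|²`:
then `‖B‖² + ‖B‖_F² / k ≤ 3 L`, while both `v / |v|` and the unit ball stretched by `M ^ (1/2)`
are images under `B` of short vectors. So the single sketching event for `B` keeps a quarter of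
`|v|²` and bounds `Sᵀ M S`; two separate events would cost twice the failure probability. -/
theorem exists_test_matrix {M : Matrix (Fin d) (Fin d) ℝ} (hM : M.PosDef)
    (hm : 0 < specNorm M) (v : Fin d → ℝ) {k : ℝ} (hk : 1 ≤ k) :
    ∃ B : Matrix (Fin d) (Fin d) ℝ, ∀ {l : ℕ} (S : Matrix (Fin d) (Fin l) ℝ),
      specNorm (B.transpose * S * S.transpose * B - B.transpose * B)
        ≤ 1 / 4 * (specNorm B ^ 2 + frobSq B / k) →
      1 / 4 * (v ⬝ᵥ v) ≤ (Sᵀ *ᵥ v) ⬝ᵥ (Sᵀ *ᵥ v) ∧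
      ∀ c : Fin l → ℝ, (S *ᵥ c) ⬝ᵥ M *ᵥ (S *ᵥ c)
        ≤ (5 * specNorm M + M.trace / k) * (c ⬝ᵥ c) := by
  have hk0 : 0 < k := by linarith
  have htr : 0 ≤ M.trace := hM.posSemidef.trace_nonneg
  obtain ⟨L, hL⟩ : ∃ L, L = specNorm M + M.trace / k := ⟨_, rfl⟩
  have hL0 : 0 < L := by rw [hL]; positivity
  have hv0 := real_dotProduct_self_nonneg v
  obtain ⟨s, hs⟩ : ∃ s, s = L / (v ⬝ᵥ v) := ⟨_, rfl⟩
  have hs0 : 0 ≤ s := by rw [hs]; positivity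
  have hsv : s * (v ⬝ᵥ v) ≤ L := by
    rw [hs]
    rcases hv0.eq_or_lt with h0 | h0
    · rw [← h0, mul_zero]; exact hL0.le
    · rw [div_mul_cancel₀ _ h0.ne']
  have hvv : (vecMulVec v v).PosSemidef := by
    simpa using posSemidef_vecMulVec_self_star v
  have hQ : (M + s • vecMulVec v v).PosDef := hM.add_posSemidef (hvv.smul hs0)
  obtain ⟨B, hB⟩ := exists_mul_transpose hQ.posSemidef
  have hBu : IsUnit B := by
    have := hQ.isUnit
    rw [hB, isUnit_iff_isUnit_det, det_mul] at this
    exact (isUnit_iff_isUnit_det B).2 (isUnit_of_mul_isUnit_left this)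
  have hBz : ∀ z, (Bᵀ *ᵥ z) ⬝ᵥ (Bᵀ *ᵥ z) = z ⬝ᵥ M *ᵥ z + s * (v ⬝ᵥ z) ^ 2 := fun z => by
    rw [← dotProduct_mul_transpose_mulVec, ← hB, add_mulVec, dotProduct_add, smul_mulVec,
      vecMulVec_mulVec]
    simp [dotProduct_comm z v, pow_two]
  have hspec : specNorm B ^ 2 ≤ specNorm M + L := by
    rw [specNorm_sq, ← hB]
    refine (specNorm_add_le _ _).trans ?_
    gcongr
    exact (specNorm_smul_vecMulVec_le hs0 v).trans hsv
  have hfrob : frobSq B ≤ M.trace + L := by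
    rw [frobSq_eq_trace, ← hB, trace_add, trace_smul, trace_vecMulVec]
    simpa using hsv
  refine ⟨B, fun {l} S hS => ?_⟩
  have hb : specNorm (Bᵀ * S * Sᵀ * B - Bᵀ * B) ≤ 3 / 4 * L := by
    refine hS.trans ?_
    have h1 : frobSq B / k ≤ M.trace / k + L := by
      calc frobSq B / k ≤ (M.trace + L) / k := by gcongr
        _ = M.trace / k + L / k := add_div _ _ _
        _ ≤ _ := by gcongr; exact div_le_self hL0.le hk
    linarith
  have key : ∀ w, |(Sᵀ *ᵥ (B *ᵥ w)) ⬝ᵥ (Sᵀ *ᵥ (B *ᵥ w)) - (B *ᵥ w) ⬝ᵥ (B *ᵥ w)|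
      ≤ 3 / 4 * L * (w ⬝ᵥ w) := fun w => by
    have h := dotProduct_mulVec_le_specNorm (Bᵀ * S * Sᵀ * B - Bᵀ * B) w
    have e : w ⬝ᵥ (Bᵀ * S * Sᵀ * B - Bᵀ * B) *ᵥ w
        = (Sᵀ *ᵥ (B *ᵥ w)) ⬝ᵥ (Sᵀ *ᵥ (B *ᵥ w)) - (B *ᵥ w) ⬝ᵥ (B *ᵥ w) := by
      rw [sub_mulVec, dotProduct_sub]
      simp only [← mulVec_mulVec]
      rw [dotProduct_mulVec_transpose Bᵀ, dotProduct_mulVec_transpose S,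
        dotProduct_mulVec_transpose Bᵀ, transpose_transpose]
    rw [← e]
    exact h.trans (mul_le_mul_of_nonneg_right hb (real_dotProduct_self_nonneg w))
  constructor
  · rcases hv0.eq_or_lt with h0 | h0
    · rw [← h0, mul_zero]; exact real_dotProduct_self_nonneg _
    obtain ⟨w, hw, hw2⟩ := exists_mulVec_eq_of_sq_le (a := v) (c := (v ⬝ᵥ v) / L) hBu
      (by positivity) fun z => by
        have hMz : 0 ≤ z ⬝ᵥ M *ᵥ z := by simpa using hM.posSemidef.dotProduct_mulVec_nonneg z
        rw [hBz, mul_add, ← mul_assoc]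
        have e : (v ⬝ᵥ v) / L * s = 1 := by rw [hs]; field_simp
        rw [e, one_mul]
        have : 0 ≤ (v ⬝ᵥ v) / L * (z ⬝ᵥ M *ᵥ z) := by positivity
        linarith
    have h := (abs_le.1 (key w)).1
    rw [hw] at h
    have : 3 / 4 * L * (w ⬝ᵥ w) ≤ 3 / 4 * (v ⬝ᵥ v) := by
      rw [le_div_iff₀ hL0] at hw2
      linarith
    linarith
  · intro c
    obtain ⟨N, hN⟩ := exists_mul_transpose hM.posSemidef
    obtain ⟨u, hu⟩ : ∃ u, u = Nᵀ *ᵥ (S *ᵥ c) := ⟨_, rfl⟩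
    have hu0 := real_dotProduct_self_nonneg u
    have hc0 := real_dotProduct_self_nonneg c
    obtain ⟨w, hw, hw2⟩ := exists_mulVec_eq_of_sq_le (a := N *ᵥ u) (c := u ⬝ᵥ u) hBu hu0
      fun z => by
        rw [hBz, dotProduct_comm, dotProduct_mulVec_transpose, dotProduct_comm]
        refine (dotProduct_sq_le _ _).trans ?_
        rw [← dotProduct_mul_transpose_mulVec, ← hN]
        gcongr
        have : 0 ≤ s * (v ⬝ᵥ z) ^ 2 := by positivity
        linarith
    have h := (abs_le.1 (key w)).2
    rw [hw] at h
    have hNu := mulVec_dotProduct_self_le N u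
    rw [specNorm_sq, ← hN] at hNu
    -- `|Sᵀ N u|² ≤ β |u|²` with `β ≤ 5 ‖M‖ + tr M / k`; the bound on `u = Nᵀ S c` is its dual
    have hβ : (Sᵀ *ᵥ (N *ᵥ u)) ⬝ᵥ (Sᵀ *ᵥ (N *ᵥ u))
        ≤ (5 * specNorm M + M.trace / k) * (u ⬝ᵥ u) := by
      have h3 : 3 / 4 * L * (w ⬝ᵥ w) ≤ 3 / 4 * L * (u ⬝ᵥ u) := by gcongr
      have h4 : (specNorm M + 3 / 4 * L) * (u ⬝ᵥ u)
          ≤ (5 * specNorm M + M.trace / k) * (u ⬝ᵥ u) := by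
        refine mul_le_mul_of_nonneg_right ?_ hu0
        have : 0 ≤ M.trace / k := by positivity
        linarith
      linarith
    have h5 : u ⬝ᵥ u = c ⬝ᵥ (Sᵀ *ᵥ (N *ᵥ u)) := by
      rw [dotProduct_mulVec_transpose, dotProduct_mulVec_transpose, transpose_transpose, ← hu]
    have h6 := dotProduct_sq_le c (Sᵀ *ᵥ (N *ᵥ u))
    rw [← h5] at h6
    have h7 := mul_le_mul_of_nonneg_left hβ hc0
    rw [hN, dotProduct_mul_transpose_mulVec, ← hu, ← hN]
    have hβ0 : 0 ≤ 5 * specNorm M + M.trace / k := by positivity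
    by_contra! hlt
    have h8 : 0 ≤ (5 * specNorm M + M.trace / k) * (c ⬝ᵥ c) := by positivity
    nlinarith

/-- If `ρ I ≼ M`, then `ρ M ≼ M²`. -/
theorem mul_dotProduct_mulVec_le {M : Matrix (Fin d) (Fin d) ℝ} {ρ : ℝ} (hρ : 0 < ρ)
    (h : ∀ w, ρ * (w ⬝ᵥ w) ≤ w ⬝ᵥ M *ᵥ w) (w : Fin d → ℝ) :
    ρ * (w ⬝ᵥ M *ᵥ w) ≤ (M *ᵥ w) ⬝ᵥ (M *ᵥ w) := by
  have h1 := dotProduct_sq_le w (M *ᵥ w)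
  have h2 := h w
  have h3 := real_dotProduct_self_nonneg (M *ᵥ w)
  have h4 := real_dotProduct_self_nonneg w
  by_contra! hlt
  nlinarith [mul_le_mul_of_nonneg_left h1 hρ.le, mul_le_mul_of_nonneg_right h2 h3]

end LinearAlgebra

/-! ### The preconditioned Hessian -/

section Preconditioner

open Matrix

variable {d : ℕ} {A H : Matrix (Fin d) (Fin d) ℝ} {ρ : ℝ}

open scoped MatrixOrder in
theorem posSemidef_invSqrt (H : Matrix (Fin d) (Fin d) ℝ) : (invSqrt H).PosSemidef :=
  (CFC.sqrt_nonneg H).posSemidef.inv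

theorem invSqrt_transpose (H : Matrix (Fin d) (Fin d) ℝ) : (invSqrt H)ᵀ = invSqrt H := by
  have h := (posSemidef_invSqrt H).1
  rwa [IsHermitian, conjTranspose_eq_transpose_of_trivial] at h

open scoped MatrixOrder in
theorem invSqrt_mul_self (hH : H.PosDef) : invSqrt H * invSqrt H = H⁻¹ := by
  rw [invSqrt, ← Matrix.mul_inv_rev, CFC.sqrt_mul_sqrt_self H hH.posSemidef.nonneg]

theorem isUnit_invSqrt (hH : H.PosDef) : IsUnit (invSqrt H) := by
  have h := hH.inv.isUnit
  rw [← invSqrt_mul_self hH, isUnit_iff_isUnit_det, det_mul] at h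
  exact (isUnit_iff_isUnit_det _).2 (isUnit_of_mul_isUnit_left h)

open scoped MatrixOrder in
theorem invSqrt_mul_mul_invSqrt (hH : H.PosDef) : invSqrt H * H * invSqrt H = 1 := by
  have h : CFC.sqrt H * CFC.sqrt H = H := CFC.sqrt_mul_sqrt_self H hH.posSemidef.nonneg
  have hu : IsUnit (CFC.sqrt H).det := by
    have := (isUnit_iff_isUnit_det _).1 (isUnit_invSqrt hH)
    rw [invSqrt] at this
    exact isUnit_nonsing_inv_det_iff.1 this
  conv_lhs => enter [1, 2]; rw [← h]
  rw [invSqrt, ← mul_assoc, nonsing_inv_mul _ hu, one_mul, mul_nonsing_inv _ hu]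

theorem trace_precond (hH : H.PosDef) : (precond A H).trace = (H⁻¹ * A).trace := by
  rw [precond, trace_mul_comm, ← mul_assoc, invSqrt_mul_self hH]

/-- `ρ H ≼ A` says that the preconditioned Hessian is at least `ρ I`. -/
theorem mul_dotProduct_self_le_precond (hH : H.PosDef) (hA : (A - ρ • H).PosSemidef)
    (w : Fin d → ℝ) : ρ * (w ⬝ᵥ w) ≤ w ⬝ᵥ precond A H *ᵥ w := by
  have h := hA.dotProduct_mulVec_nonneg (invSqrt H *ᵥ w)
  rw [star_trivial, sub_mulVec, dotProduct_sub, smul_mulVec, dotProduct_smul] at h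
  have e : ∀ X : Matrix (Fin d) (Fin d) ℝ, (invSqrt H *ᵥ w) ⬝ᵥ X *ᵥ (invSqrt H *ᵥ w)
      = w ⬝ᵥ (invSqrt H * X * invSqrt H) *ᵥ w := fun X => by
    simp only [← mulVec_mulVec]
    rw [dotProduct_mulVec_transpose (invSqrt H), invSqrt_transpose]
  rw [e, e, invSqrt_mul_mul_invSqrt hH, one_mulVec, smul_eq_mul] at h
  rw [precond]
  linarith

theorem posDef_precond (hH : H.PosDef) (hA : A.PosSemidef) (hρ : 0 < ρ)
    (hAH : (A - ρ • H).PosSemidef) : (precond A H).PosDef := by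
  refine .of_dotProduct_mulVec_pos ?_ fun w hw => ?_
  · have h := hA.mul_mul_conjTranspose_same (invSqrt H)
    rw [conjTranspose_eq_transpose_of_trivial, invSqrt_transpose] at h
    exact h.1
  · rw [star_trivial]
    refine lt_of_lt_of_le ?_ (mul_dotProduct_self_le_precond hH hAH w)
    have : 0 < w ⬝ᵥ w := by simpa using dotProduct_star_self_pos_iff.2 hw
    positivity

theorem le_specNorm_precond (hd : 0 < d) (hH : H.PosDef)
    (hAH : (A - ρ • H).PosSemidef) : ρ ≤ specNorm (precond A H) := by
  have h1 := mul_dotProduct_self_le_precond hH hAH (Pi.single ⟨0, hd⟩ 1)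
  have h2 := (le_abs_self _).trans
    (dotProduct_mulVec_le_specNorm (precond A H) (Pi.single ⟨0, hd⟩ 1))
  have e : (Pi.single (⟨0, hd⟩ : Fin d) (1 : ℝ)) ⬝ᵥ Pi.single ⟨0, hd⟩ 1 = 1 := by simp
  rw [e] at h1 h2
  linarith

end Preconditioner

/-! ### Running the algorithm -/

section Programs

namespace ZOProg

variable {E β β' : Type}

theorem output_bind (f : E → ℝ) (p : ZOProg E β) (g : β → ZOProg E β') :
    (p.bind g).output f = (g (p.output f)).output f := by
  induction p with
  | ret b => rfl
  | query x next ih => exact ih (f x)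

theorem queries_bind (f : E → ℝ) (p : ZOProg E β) (g : β → ZOProg E β') :
    (p.bind g).queries f = p.queries f + (g (p.output f)).queries f := by
  induction p with
  | ret b => simp [bind, queries, output]
  | query x next ih =>
    have := ih (f x)
    simp only [bind, queries, output, this]
    omega

end ZOProg

variable {d l : ℕ}

theorem output_estimate (f : EuclideanSpace ℝ (Fin d) → ℝ) (α : ℝ) (x : EuclideanSpace ℝ (Fin d))
    (us : List (EuclideanSpace ℝ (Fin d))) :
    (estimate α x us).output f
      = (us.map fun u => ((f (x + α • u) - f (x - α • u)) / (2 * α)) • u).sum := by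
  induction us with
  | nil => rfl
  | cons u us ih => simp [estimate, ZOProg.output, ZOProg.output_bind, ih]

theorem queries_estimate (f : EuclideanSpace ℝ (Fin d) → ℝ) (α : ℝ) (x : EuclideanSpace ℝ (Fin d))
    (us : List (EuclideanSpace ℝ (Fin d))) :
    (estimate α x us).queries f = 2 * us.length := by
  induction us with
  | nil => rfl
  | cons u us ih =>
    simp only [estimate, ZOProg.queries, ZOProg.queries_bind, ih, List.length_cons]
    omega

/-- The search direction `H ^ (-1/2) s⁽ⁱ⁾`. -/
noncomputable def direction (H : Matrix (Fin d) (Fin d) ℝ) (S : Matrix (Fin d) (Fin l) ℝ)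
    (i : Fin l) : EuclideanSpace ℝ (Fin d) :=
  WithLp.toLp 2 ((invSqrt H).mulVec fun j => S j i)

/-- The symmetric difference quotient of `f` at `x` along the `i`-th search direction. -/
noncomputable def diffQuot (f : EuclideanSpace ℝ (Fin d) → ℝ) (α : ℝ) (H : Matrix (Fin d) (Fin d) ℝ)
    (x : EuclideanSpace ℝ (Fin d)) (S : Matrix (Fin d) (Fin l) ℝ) (i : Fin l) : ℝ :=
  (f (x + α • direction H S i) - f (x - α • direction H S i)) / (2 * α)

/-- One iteration of the algorithm as a map of the current point and the sketching matrix. -/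
noncomputable def step (f : EuclideanSpace ℝ (Fin d) → ℝ) (α η : ℝ) (H : Matrix (Fin d) (Fin d) ℝ)
    (x : EuclideanSpace ℝ (Fin d)) (S : Matrix (Fin d) (Fin l) ℝ) : EuclideanSpace ℝ (Fin d) :=
  x - η • ∑ i, diffQuot f α H x S i • direction H S i

theorem output_hessianAware_succ (f : EuclideanSpace ℝ (Fin d) → ℝ) (α : ℝ) (η : ℕ → ℝ)
    (H : ℕ → Matrix (Fin d) (Fin d) ℝ) (S : ℕ → Matrix (Fin d) (Fin l) ℝ)
    (x₀ : EuclideanSpace ℝ (Fin d)) (t : ℕ) :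
    (hessianAware α η H S x₀ (t + 1)).output f
      = step f α (η t) (H t) ((hessianAware α η H S x₀ t).output f) (S t) := by
  simp only [hessianAware, ZOProg.output_bind, output_estimate, ZOProg.output, directions,
    List.map_ofFn, List.sum_ofFn]
  rfl

theorem queries_hessianAware (f : EuclideanSpace ℝ (Fin d) → ℝ) (α : ℝ) (η : ℕ → ℝ)
    (H : ℕ → Matrix (Fin d) (Fin d) ℝ) (S : ℕ → Matrix (Fin d) (Fin l) ℝ)
    (x₀ : EuclideanSpace ℝ (Fin d)) (t : ℕ) :
    (hessianAware α η H S x₀ t).queries f = 2 * l * t := by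
  induction t with
  | zero => rfl
  | succ t ih =>
    simp only [hessianAware, ZOProg.queries_bind, queries_estimate, ZOProg.queries, ih, directions,
      List.length_ofFn]
    ring

theorem measurable_entry {m n : Type*} (i : m) (j : n) :
    Measurable fun S : Matrix m n ℝ => S i j :=
  (measurable_pi_apply j).comp (measurable_pi_apply (X := fun _ : m => n → ℝ) i)

theorem measurable_direction (H : Matrix (Fin d) (Fin d) ℝ) (i : Fin l) :
    Measurable fun S : Matrix (Fin d) (Fin l) ℝ => direction H S i := by
  refine (WithLp.measurable_toLp 2 _).comp (measurable_pi_lambda _ fun a => ?_)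
  simp only [Matrix.mulVec, dotProduct]
  exact Finset.measurable_fun_sum _ fun j _ => (measurable_entry j i).const_mul _

theorem measurable_step {f : EuclideanSpace ℝ (Fin d) → ℝ} (hf : Measurable f) (α η : ℝ)
    (H : Matrix (Fin d) (Fin d) ℝ) :
    Measurable fun p : EuclideanSpace ℝ (Fin d) × Matrix (Fin d) (Fin l) ℝ =>
      step f α η H p.1 p.2 := by
  have hd : ∀ i, Measurable fun p : EuclideanSpace ℝ (Fin d) × Matrix (Fin d) (Fin l) ℝ =>
      direction H p.2 i := fun i => (measurable_direction H i).comp measurable_snd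
  have hp : ∀ i, Measurable fun p : EuclideanSpace ℝ (Fin d) × Matrix (Fin d) (Fin l) ℝ =>
      p.1 + α • direction H p.2 i := fun i => measurable_fst.add ((hd i).const_smul α)
  have hm : ∀ i, Measurable fun p : EuclideanSpace ℝ (Fin d) × Matrix (Fin d) (Fin l) ℝ =>
      p.1 - α • direction H p.2 i := fun i => measurable_fst.sub ((hd i).const_smul α)
  have hq : ∀ i, Measurable fun p : EuclideanSpace ℝ (Fin d) × Matrix (Fin d) (Fin l) ℝ =>
      diffQuot f α H p.1 p.2 i := fun i =>
    ((hf.comp (hp i)).sub (hf.comp (hm i))).div_const _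
  have hs : Measurable fun p : EuclideanSpace ℝ (Fin d) × Matrix (Fin d) (Fin l) ℝ =>
      ∑ i, diffQuot f α H p.1 p.2 i • direction H p.2 i :=
    Finset.measurable_fun_sum _ fun i _ => (hq i).smul (hd i)
  exact measurable_fst.sub (hs.const_smul η)

end Programs

/-! ### One iteration on a noisy quadratic -/

section Descent

open Matrix

variable {d l : ℕ} {φ f : EuclideanSpace ℝ (Fin d) → ℝ} {A H : Matrix (Fin d) (Fin d) ℝ}
  {xstar : EuclideanSpace ℝ (Fin d)}

/-- At a minimizer the linear term of a convex quadratic vanishes. -/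
theorem IsConvexQuadratic.sub_min_eq (hφ : IsConvexQuadratic φ A) (hmin : ∀ x, φ xstar ≤ φ x)
    (x : EuclideanSpace ℝ (Fin d)) :
    φ x - φ xstar = 1 / 2 * ((x - xstar).ofLp ⬝ᵥ A *ᵥ (x - xstar).ofLp) := by
  have hg : gradient φ xstar = 0 := by
    simp [gradient, IsLocalMin.fderiv_eq_zero (Filter.Eventually.of_forall hmin)]
  have h := hφ.2 xstar x
  rw [hg, inner_zero_left] at h
  have e : inner ℝ (x - xstar) (Matrix.toEuclideanLin A (x - xstar))
      = (x - xstar).ofLp ⬝ᵥ A *ᵥ (x - xstar).ofLp := by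
    rw [Matrix.toLpLin_apply, EuclideanSpace.inner_eq_star_dotProduct, dotProduct_comm]
    simp
  rw [← e]
  linarith

theorem IsConvexQuadratic.diffQuot_eq (hφ : IsConvexQuadratic φ A) (hmin : ∀ x, φ xstar ≤ φ x)
    {α : ℝ} (hα : 0 < α) (x : EuclideanSpace ℝ (Fin d)) (S : Matrix (Fin d) (Fin l) ℝ)
    (i : Fin l) :
    diffQuot φ α H x S i = (Sᵀ *ᵥ (invSqrt H *ᵥ (A *ᵥ (x - xstar).ofLp))) i := by
  have hs : Aᵀ = A := by simpa [conjTranspose_eq_transpose_of_trivial] using hφ.1.1.eq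
  obtain ⟨y, hy⟩ : ∃ y, y = (x - xstar).ofLp := ⟨_, rfl⟩
  obtain ⟨u, hu⟩ : ∃ u, u = (direction H S i).ofLp := ⟨_, rfl⟩
  have e1 : (x + α • direction H S i - xstar).ofLp = y + α • u := by
    ext j; simp [hy, hu]; ring
  have e2 : (x - α • direction H S i - xstar).ofLp = y - α • u := by
    ext j; simp [hy, hu]; ring
  have e3 : y ⬝ᵥ A *ᵥ u = u ⬝ᵥ A *ᵥ y := by
    rw [dotProduct_mulVec_transpose, hs, dotProduct_comm]
  have e4 : (Sᵀ *ᵥ (invSqrt H *ᵥ (A *ᵥ y))) i = u ⬝ᵥ A *ᵥ y := by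
    rw [hu, direction]
    change (fun j => S j i) ⬝ᵥ (invSqrt H *ᵥ (A *ᵥ y)) = _
    rw [dotProduct_mulVec_transpose, invSqrt_transpose]
  rw [diffQuot, ← hy, e4]
  have h1 := hφ.sub_min_eq hmin (x + α • direction H S i)
  have h2 := hφ.sub_min_eq hmin (x - α • direction H S i)
  rw [e1] at h1
  rw [e2] at h2
  simp only [mulVec_add, mulVec_sub, mulVec_smul, dotProduct_add, add_dotProduct, sub_dotProduct,
    dotProduct_sub, smul_dotProduct, dotProduct_smul, smul_eq_mul, e3] at h1 h2
  rw [div_eq_iff (by positivity)]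
  linarith

theorem abs_diffQuot_sub_le {σ α : ℝ} (hα : 0 < α) (hfφ : ∀ x, |f x - φ x| ≤ σ)
    (x : EuclideanSpace ℝ (Fin d)) (S : Matrix (Fin d) (Fin l) ℝ) (i : Fin l) :
    |diffQuot f α H x S i - diffQuot φ α H x S i| ≤ σ / α := by
  have h1 := abs_le.1 (hfφ (x + α • direction H S i))
  have h2 := abs_le.1 (hfφ (x - α • direction H S i))
  rw [diffQuot, diffQuot, ← sub_div, abs_div, abs_of_pos (by positivity : 0 < 2 * α),
    div_le_div_iff₀ (by positivity) hα]
  have : |f (x + α • direction H S i) - f (x - α • direction H S i)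
      - (φ (x + α • direction H S i) - φ (x - α • direction H S i))| ≤ 2 * σ := by
    rw [abs_le]; constructor <;> linarith
  nlinarith

theorem step_sub_ofLp (f : EuclideanSpace ℝ (Fin d) → ℝ) (α η : ℝ)
    (x : EuclideanSpace ℝ (Fin d)) (S : Matrix (Fin d) (Fin l) ℝ) :
    (step f α η H x S - xstar).ofLp
      = (x - xstar).ofLp - η • (invSqrt H *ᵥ (S *ᵥ diffQuot f α H x S)) := by
  have : (∑ i, diffQuot f α H x S i • direction H S i).ofLp
      = invSqrt H *ᵥ (S *ᵥ diffQuot f α H x S) := by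
    rw [WithLp.ofLp_sum]
    ext j
    simp only [Finset.sum_apply, WithLp.ofLp_smul, Pi.smul_apply, direction, mulVec, dotProduct,
      smul_eq_mul, Finset.mul_sum]
    rw [Finset.sum_comm]
    exact Finset.sum_congr rfl fun a _ => Finset.sum_congr rfl fun b _ => by ring
  rw [step, WithLp.ofLp_sub, WithLp.ofLp_sub, WithLp.ofLp_sub, WithLp.ofLp_smul, this]
  abel

/-- The gap shrinks by the factor `1 - η ρ / 4`, up to noise, as soon as the sketch keeps a quarter
of `|H ^ (-1/2) ∇φ x|²` and the step size is below the curvature met along the directions. With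
`q = Sᵀ H ^ (-1/2) ∇φ x` and `n` the noise in the difference quotients, twice the gap changes by at
most `-2 η ⟨q + n, q⟩ + η |q + n|² = η (|n|² - |q|²)`. -/
theorem IsConvexQuadratic.step_gap_le (hφ : IsConvexQuadratic φ A) (hmin : ∀ x, φ xstar ≤ φ x)
    {σ α η ρ : ℝ} (hα : 0 < α) (hη : 0 < η) (hρ : 0 < ρ)
    (hfφ : ∀ x, |f x - φ x| ≤ σ) (hH : H.PosDef) (hAH : (A - ρ • H).PosSemidef)
    (x : EuclideanSpace ℝ (Fin d)) (S : Matrix (Fin d) (Fin l) ℝ)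
    (h1 : 1 / 4 * ((invSqrt H *ᵥ (A *ᵥ (x - xstar).ofLp)) ⬝ᵥ
        (invSqrt H *ᵥ (A *ᵥ (x - xstar).ofLp)))
      ≤ (Sᵀ *ᵥ (invSqrt H *ᵥ (A *ᵥ (x - xstar).ofLp))) ⬝ᵥ
        (Sᵀ *ᵥ (invSqrt H *ᵥ (A *ᵥ (x - xstar).ofLp))))
    (h2 : ∀ c : Fin l → ℝ, (S *ᵥ c) ⬝ᵥ precond A H *ᵥ (S *ᵥ c) ≤ η⁻¹ * (c ⬝ᵥ c)) :
    φ (step f α η H x S) - φ xstar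
      ≤ (1 - η * ρ / 4) * (φ x - φ xstar) + η * (l * σ ^ 2 / (2 * α ^ 2)) := by
  have hs : Aᵀ = A := by simpa [conjTranspose_eq_transpose_of_trivial] using hφ.1.1.eq
  obtain ⟨y, hy⟩ : ∃ y, y = (x - xstar).ofLp := ⟨_, rfl⟩
  obtain ⟨c, hc⟩ : ∃ c, c = diffQuot f α H x S := ⟨_, rfl⟩
  obtain ⟨v, hv⟩ : ∃ v, v = invSqrt H *ᵥ (A *ᵥ y) := ⟨_, rfl⟩
  obtain ⟨q, hq⟩ : ∃ q, q = Sᵀ *ᵥ v := ⟨_, rfl⟩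
  rw [← hy, ← hv, ← hq] at h1
  rw [hφ.sub_min_eq hmin, hφ.sub_min_eq hmin, step_sub_ofLp, ← hy, ← hc]
  have hn : (c - q) ⬝ᵥ (c - q) ≤ l * σ ^ 2 / α ^ 2 := by
    have : ∀ i ∈ Finset.univ, (c - q) i * (c - q) i ≤ (σ / α) ^ 2 := fun i _ => by
      have h := abs_diffQuot_sub_le (H := H) hα hfφ x S i
      rw [hφ.diffQuot_eq hmin hα, ← hy, ← hv, ← hq, ← hc] at h
      rw [← pow_two, ← sq_abs]
      exact pow_le_pow_left₀ (abs_nonneg _) h 2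
    refine (Finset.sum_le_card_nsmul _ _ _ this).trans_eq ?_
    simp [div_pow, mul_div_assoc]
  have hcross : y ⬝ᵥ A *ᵥ (invSqrt H *ᵥ (S *ᵥ c)) = q ⬝ᵥ c := by
    rw [dotProduct_mulVec_transpose, hs, dotProduct_mulVec_transpose, invSqrt_transpose, ← hv,
      dotProduct_mulVec_transpose, ← hq]
  have hcross' : (invSqrt H *ᵥ (S *ᵥ c)) ⬝ᵥ A *ᵥ y = q ⬝ᵥ c := by
    rw [← hcross, dotProduct_mulVec_transpose, hs, dotProduct_comm]
  have hquad : (invSqrt H *ᵥ (S *ᵥ c)) ⬝ᵥ A *ᵥ (invSqrt H *ᵥ (S *ᵥ c))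
      = (S *ᵥ c) ⬝ᵥ precond A H *ᵥ (S *ᵥ c) := by
    rw [precond]
    simp only [← mulVec_mulVec]
    rw [dotProduct_mulVec_transpose (invSqrt H), invSqrt_transpose]
  have hc2 : η * (η * ((S *ᵥ c) ⬝ᵥ precond A H *ᵥ (S *ᵥ c))) ≤ η * (c ⬝ᵥ c) := by
    refine mul_le_mul_of_nonneg_left ?_ hη.le
    calc η * ((S *ᵥ c) ⬝ᵥ precond A H *ᵥ (S *ᵥ c)) ≤ η * (η⁻¹ * (c ⬝ᵥ c)) := by
          gcongr; exact h2 c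
      _ = c ⬝ᵥ c := by rw [← mul_assoc, mul_inv_cancel₀ hη.ne', one_mul]
  have hv2 : ρ * (y ⬝ᵥ A *ᵥ y) ≤ v ⬝ᵥ v := by
    obtain ⟨w, hw⟩ := (mulVec_surjective_iff_isUnit.2 (isUnit_invSqrt hH)) y
    have h := mul_dotProduct_mulVec_le hρ (mul_dotProduct_self_le_precond hH hAH) w
    have e1 : precond A H *ᵥ w = v := by rw [hv, ← hw, precond]; simp only [← mulVec_mulVec]
    have e2 : w ⬝ᵥ precond A H *ᵥ w = y ⬝ᵥ A *ᵥ y := by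
      rw [precond, ← hw]
      simp only [← mulVec_mulVec]
      rw [dotProduct_mulVec_transpose (invSqrt H), invSqrt_transpose]
    rwa [e2, e1] at h
  have hexp : (c - q) ⬝ᵥ (c - q) = c ⬝ᵥ c - 2 * (q ⬝ᵥ c) + q ⬝ᵥ q := by
    rw [sub_dotProduct, dotProduct_sub, dotProduct_sub, dotProduct_comm c q]; ring
  simp only [mulVec_sub, mulVec_smul, dotProduct_sub, sub_dotProduct, smul_dotProduct,
    dotProduct_smul, smul_eq_mul, hcross, hcross', hquad]
  have hq2 : ρ / 4 * (y ⬝ᵥ A *ᵥ y) ≤ q ⬝ᵥ q := by linarith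
  have h5 := mul_le_mul_of_nonneg_left hq2 hη.le
  have h6 := mul_le_mul_of_nonneg_left hn hη.le
  rw [hexp] at h6
  have e : η * (l * σ ^ 2 / (2 * α ^ 2)) = 1 / 2 * (η * (l * σ ^ 2 / α ^ 2)) := by
    field_simp
  rw [e]
  linarith

end Descent

/-! ### Adaptive sequences of independent draws -/

section AdaptiveUnionBound

variable {Ω X E : Type*}

/-- The orbit of `x₀` when step `t` is driven by the `t`-th term of a sequence. -/
def orbit (F : ℕ → E → X → E) (x₀ : E) (s : ℕ → X) : ℕ → E
  | 0 => x₀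
  | t + 1 => F t (orbit F x₀ s t) (s t)

theorem orbit_congr (F : ℕ → E → X → E) (x₀ : E) {s s' : ℕ → X} {t : ℕ}
    (h : ∀ i < t, s i = s' i) : orbit F x₀ s t = orbit F x₀ s' t := by
  induction t with
  | zero => rfl
  | succ t ih => rw [orbit, orbit, ih fun i hi => h i (by omega), h t (by omega)]

variable [MeasurableSpace Ω] [MeasurableSpace X] [MeasurableSpace E]

theorem measurable_orbit {F : ℕ → E → X → E} (hF : ∀ t, Measurable fun p : E × X => F t p.1 p.2)
    (x₀ : E) (t : ℕ) : Measurable fun s : ℕ → X => orbit F x₀ s t := by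
  induction t with
  | zero => exact measurable_const
  | succ t ih => exact (hF t).comp (ih.prodMk (measurable_pi_apply t))

variable {P : Measure Ω} [Inhabited X]

/-- The current point depends only on earlier draws, hence is independent of the current one. -/
theorem indepFun_orbit {F : ℕ → E → X → E} (hF : ∀ t, Measurable fun p : E × X => F t p.1 p.2)
    (x₀ : E) {T : ℕ} {S : ℕ → Ω → X} (hS : ∀ t < T, Measurable (S t))
    (hind : iIndepFun (fun t : Fin T => S t) P) {t : ℕ} (ht : t < T) :
    IndepFun (fun ω => orbit F x₀ (fun i => S i ω) t) (S t) P := by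
  classical
  obtain ⟨past, hpast⟩ : ∃ past : Finset (Fin T), past = Finset.univ.filter fun i => i.1 < t :=
    ⟨_, rfl⟩
  have h := hind.indepFun_finset past {⟨t, ht⟩} (by simp [hpast]) fun i => hS i i.2
  have hmem : ∀ i (hi : i < T), i < t → (⟨i, hi⟩ : Fin T) ∈ past := fun i hi hit => by
    simp [hpast, hit]
  let extend (r : past → X) (i : ℕ) : X :=
    if hi : i < T ∧ i < t then r ⟨⟨i, hi.1⟩, hmem i hi.1 hi.2⟩ else default
  have h_extend : Measurable extend := measurable_pi_lambda _ fun i => by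
    by_cases hi : i < T ∧ i < t
    · simp only [extend, hi, and_self, dite_true]; exact measurable_pi_apply _
    · simp only [extend, hi, dite_false]; exact measurable_const
  have h2 := h.comp ((measurable_orbit hF x₀ t).comp h_extend)
    (measurable_pi_apply (⟨⟨t, ht⟩, Finset.mem_singleton_self _⟩ : ({⟨t, ht⟩} : Finset (Fin T))))
  have e : (fun ω => orbit F x₀ (fun i => S i ω) t)
      = ((fun s => orbit F x₀ s t) ∘ extend) ∘ fun ω (i : past) => S i.1 ω := by
    funext ω
    refine orbit_congr F x₀ fun i hi => ?_
    simp [extend, hi, hi.trans ht]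
  rw [e]
  exact h2

/-- Union bound along an adaptive orbit: if at every fixed point the draw `S t` is good with
probability at least `1 - δ / T`, then all `T` draws are good at the points actually reached with
probability at least `1 - δ`. -/
theorem one_sub_le_measureReal_orbit [IsProbabilityMeasure P] {F : ℕ → E → X → E}
    (hF : ∀ t, Measurable fun p : E × X => F t p.1 p.2) (x₀ : E) {T : ℕ} (hT : 1 ≤ T)
    {S : ℕ → Ω → X} (hS : ∀ t < T, Measurable (S t))
    (hind : iIndepFun (fun t : Fin T => S t) P) {G : ℕ → Set (E × X)}
    (hG : ∀ t, MeasurableSet (G t)) {δ : ℝ} (hδ : 0 ≤ δ)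
    (hgood : ∀ t < T, ∀ x, 1 - δ / T ≤ P.real {ω | (x, S t ω) ∈ G t}) :
    1 - δ ≤ P.real {ω | ∀ t < T, (orbit F x₀ (fun i => S i ω) t, S t ω) ∈ G t} := by
  have hT0 : (0 : ℝ) < T := by exact_mod_cast hT
  obtain ⟨x, hx⟩ : ∃ x : ℕ → Ω → E, x = fun t ω => orbit F x₀ (fun i => S i ω) t := ⟨_, rfl⟩
  have hxm : ∀ t ≤ T, Measurable (x t) := fun t ht => by
    induction t with
    | zero => rw [hx]; exact measurable_const
    | succ t ih =>
      have h := (hF t).comp ((ih (by omega)).prodMk (hS t ht))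
      rw [hx] at h ⊢
      exact h
  have hbad : ∀ t < T, P {ω | (x t ω, S t ω) ∉ G t} ≤ ENNReal.ofReal (δ / T) := fun t ht => by
    have hm := hxm t ht.le
    have hp := (indepFun_iff_map_prod_eq_prod_map_map hm.aemeasurable (hS t ht).aemeasurable).1
      (by rw [hx]; exact indepFun_orbit hF x₀ hS hind ht)
    have e : P {ω | (x t ω, S t ω) ∉ G t}
        = (P.map fun ω => (x t ω, S t ω)) (G t)ᶜ := by
      rw [Measure.map_apply (hm.prodMk (hS t ht)) (hG t).compl]; rfl
    have := Measure.isProbabilityMeasure_map (μ := P) hm.aemeasurable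
    have := Measure.isProbabilityMeasure_map (μ := P) (hS t ht).aemeasurable
    rw [e, hp, Measure.prod_apply (hG t).compl]
    refine (lintegral_mono (g := fun _ => ENNReal.ofReal (δ / T)) fun y => ?_).trans (by simp)
    have hy : MeasurableSet (Prod.mk y ⁻¹' (G t)) := measurable_prodMk_left (hG t)
    change (P.map (S t)) (Prod.mk y ⁻¹' (G t)ᶜ) ≤ _
    rw [Measure.map_apply (hS t ht) (measurable_prodMk_left (hG t).compl)]
    have h1 := hgood t ht y
    have h2 := probReal_compl_eq_one_sub (μ := P) (hS t ht hy)
    rw [← ofReal_measureReal]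
    refine ENNReal.ofReal_le_ofReal ?_
    have e2 : S t ⁻¹' (Prod.mk y ⁻¹' (G t)ᶜ) = (S t ⁻¹' (Prod.mk y ⁻¹' G t))ᶜ := rfl
    rw [e2, h2]
    have e3 : {ω | (y, S t ω) ∈ G t} = S t ⁻¹' (Prod.mk y ⁻¹' G t) := rfl
    rw [e3] at h1
    linarith
  have hgm : MeasurableSet {ω | ∀ t < T, (x t ω, S t ω) ∈ G t} := by
    have : {ω | ∀ t < T, (x t ω, S t ω) ∈ G t}
        = ⋂ t ∈ Finset.range T, {ω | (x t ω, S t ω) ∈ G t} := by ext; simp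
    rw [this]
    refine Finset.measurableSet_biInter _ fun t ht => ?_
    have ht := Finset.mem_range.1 ht
    exact ((hxm t ht.le).prodMk (hS t ht)) (hG t)
  have hc : P.real {ω | ∀ t < T, (x t ω, S t ω) ∈ G t}ᶜ ≤ δ := by
    refine ENNReal.toReal_le_of_le_ofReal hδ ?_
    calc P {ω | ∀ t < T, (x t ω, S t ω) ∈ G t}ᶜ
        ≤ P (⋃ t ∈ Finset.range T, {ω | (x t ω, S t ω) ∉ G t}) := by
          refine measure_mono fun ω hω => ?_
          simpa using hω
      _ ≤ ∑ t ∈ Finset.range T, P {ω | (x t ω, S t ω) ∉ G t} := measure_biUnion_finset_le _ _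
      _ ≤ ∑ t ∈ Finset.range T, ENNReal.ofReal (δ / T) :=
          Finset.sum_le_sum fun t ht => hbad t (Finset.mem_range.1 ht)
      _ = ENNReal.ofReal δ := by
          rw [Finset.sum_const, Finset.card_range, nsmul_eq_mul, ← ENNReal.ofReal_natCast,
            ← ENNReal.ofReal_mul hT0.le, mul_div_cancel₀ _ hT0.ne']
  rw [probReal_compl_eq_one_sub hgm, hx] at hc
  linarith

end AdaptiveUnionBound

/-! ### Contraction to a noise level -/

section Rate

/-- Contraction by at least `1 - a` towards the level `R`. -/
theorem le_pow_mul_add_of_contraction {e b : ℕ → ℝ} {a R : ℝ} {T : ℕ} (h0 : 0 ≤ e 0) (ha : a ≤ 1)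
    (hb : ∀ t < T, a ≤ b t ∧ b t ≤ 1)
    (he : ∀ t < T, e (t + 1) ≤ (1 - b t) * e t + b t * R) (hR : 0 ≤ R) :
    e T ≤ (1 - a) ^ T * e 0 + R := by
  have : ∀ t ≤ T, e t ≤ (1 - a) ^ t * e 0 + R := fun t ht => by
    induction t with
    | zero => simpa using hR
    | succ t ih =>
      obtain ⟨h1, h2⟩ := hb t (by omega)
      have h3 := ih (by omega)
      have h4 := mul_le_mul_of_nonneg_left h3 (sub_nonneg.2 h2)
      have h5 : (1 - b t) * ((1 - a) ^ t * e 0) ≤ (1 - a) * ((1 - a) ^ t * e 0) := by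
        have : 0 ≤ (1 - a) ^ t * e 0 := mul_nonneg (pow_nonneg (by linarith) _) h0
        exact mul_le_mul_of_nonneg_right (by linarith) this
      have h6 := he t (by omega)
      rw [pow_succ]
      linarith
  exact this T le_rfl

theorem half_le_log_inv {ε : ℝ} (hε : 0 < ε) (hε2 : ε ≤ 1 / 2) : 1 / 2 ≤ Real.log (1 / ε) := by
  have h : Real.log 2 ≤ Real.log (1 / ε) := by
    refine Real.log_le_log (by norm_num) ?_
    rw [le_div_iff₀ hε]
    linarith
  linarith [Real.log_two_gt_d9]

/-- After `2 (1 + log⁺ Δ) log (1 / ε)` time constants `a⁻¹`, a gap `Δ` has shrunk below `ε`. -/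
theorem pow_mul_le_of_le {a Δ ε : ℝ} {T : ℕ} (ha : a ≤ 1) (hΔ : 0 ≤ Δ) (hε : 0 < ε)
    (hε2 : ε ≤ 1 / 2) (h : 2 * (1 + Real.posLog Δ) * Real.log (1 / ε) ≤ a * T) :
    (1 - a) ^ T * Δ ≤ ε := by
  have hlog := half_le_log_inv hε hε2
  have hp : 0 ≤ Real.posLog Δ := Real.posLog_nonneg
  have hsum : Real.posLog Δ + Real.log (1 / ε) ≤ a * T := by nlinarith
  have hΔexp : Δ ≤ Real.exp (Real.posLog Δ) := by
    rcases hΔ.eq_or_lt with h0 | h0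
    · rw [← h0]; positivity
    · calc Δ = Real.exp (Real.log Δ) := (Real.exp_log h0).symm
        _ ≤ _ := Real.exp_le_exp.2 (le_max_right _ _)
  calc (1 - a) ^ T * Δ ≤ Real.exp (-a) ^ T * Real.exp (Real.posLog Δ) := by
        have := Real.add_one_le_exp (-a)
        gcongr
        · linarith
    _ = Real.exp (Real.posLog Δ - a * T) := by
        rw [← Real.exp_nat_mul, ← Real.exp_add]; ring_nf
    _ ≤ Real.exp (-Real.log (1 / ε)) := Real.exp_le_exp.2 (by linarith)
    _ = ε := by rw [one_div, Real.log_inv, neg_neg, Real.exp_log hε]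

end Rate

/-! ### Step sizes and complexity bounds -/

section Complexity

variable {d l : ℕ} {A : Matrix (Fin d) (Fin d) ℝ} {H : ℕ → Matrix (Fin d) (Fin d) ℝ} {ρ : ℕ → ℝ}
  {k : ℝ}

theorem trace_inv_mul_nonneg (hA : A.PosSemidef) {H : Matrix (Fin d) (Fin d) ℝ} (hH : H.PosDef) :
    0 ≤ (H⁻¹ * A).trace := by
  rw [← trace_precond hH, precond]
  have h := hA.mul_mul_conjTranspose_same (invSqrt H)
  rw [Matrix.conjTranspose_eq_transpose_of_trivial, invSqrt_transpose] at h
  exact h.trace_nonneg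

theorem one_le_iterTerm (hd : 0 < d) (hA : A.PosSemidef) {H : Matrix (Fin d) (Fin d) ℝ} {ρ : ℝ}
    (hH : H.PosDef) (hρ : 0 < ρ) (hAH : (A - ρ • H).PosSemidef) (hk : 1 ≤ k) :
    1 ≤ iterTerm A H ρ k := by
  have h1 := le_specNorm_precond hd hH hAH
  have h2 : 0 ≤ (H⁻¹ * A).trace / k := div_nonneg (trace_inv_mul_nonneg hA hH) (by linarith)
  rw [iterTerm, inv_mul_eq_div, le_div_iff₀ hρ]
  linarith

/-- The contraction rate `η_t ρ_t / 4` is at least `1 / (20 iterTerm)` and at most `1`. -/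
theorem stepSize_rate (hd : 0 < d) (hA : A.PosSemidef) {H : Matrix (Fin d) (Fin d) ℝ} {ρ : ℝ}
    (hH : H.PosDef) (hρ : 0 < ρ) (hAH : (A - ρ • H).PosSemidef) (hk : 1 ≤ k) :
    0 < stepSize A H k ∧ (20 * iterTerm A H ρ k)⁻¹ ≤ stepSize A H k * ρ / 4 ∧
      stepSize A H k * ρ / 4 ≤ 1 := by
  have h1 := le_specNorm_precond hd hH hAH
  have h2 : 0 ≤ (H⁻¹ * A).trace / k := div_nonneg (trace_inv_mul_nonneg hA hH) (by linarith)
  unfold stepSize iterTerm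
  obtain ⟨τ, hτ⟩ : ∃ τ, τ = (H⁻¹ * A).trace / k := ⟨_, rfl⟩
  obtain ⟨m, hm⟩ : ∃ m, m = specNorm (precond A H) := ⟨_, rfl⟩
  rw [← hτ] at h2 ⊢
  rw [← hm] at h1 ⊢
  have hm0 : 0 < m := by linarith
  have h5 : 0 < 5 * m + τ := by positivity
  refine ⟨by positivity, ?_, ?_⟩
  · have e : (20 * (ρ⁻¹ * (m + τ)))⁻¹ = ρ / (20 * (m + τ)) := by field_simp
    have e' : (5 * m + τ)⁻¹ * ρ / 4 = ρ / (4 * (5 * m + τ)) := by field_simp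
    rw [e, e']
    gcongr ρ / ?_
    linarith
  · have e' : (5 * m + τ)⁻¹ * ρ / 4 = ρ / (4 * (5 * m + τ)) := by field_simp
    rw [e', div_le_one (by positivity)]
    linarith

theorem iterBound_le_succ {C Δ ε : ℝ} (hC : 0 ≤ C) (hε : 0 < ε) (hε2 : ε ≤ 1 / 2) {T : ℕ}
    (hT : 1 ≤ T) : iterBound C Δ A H ρ k ε T ≤ iterBound C Δ A H ρ k ε (T + 1) := by
  have hlog := half_le_log_inv hε hε2
  have hp : 0 ≤ Real.posLog Δ := Real.posLog_nonneg
  have : Nonempty (Fin T) := ⟨⟨0, hT⟩⟩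
  unfold iterBound
  gcongr
  exact ciSup_le fun t => le_ciSup (f := fun t : Fin (T + 1) => iterTerm A (H t) (ρ t) k)
    (Set.finite_range _).bddAbove t.castSucc

/-- The least `T ≥ 1` with `N(T) ≤ T` also satisfies `T ≤ 2 N(T)`, because `N` is monotone, bounded
and at least `1 / 2`. -/
theorem exists_iterBound_le {C Δ ε : ℝ} (hC : 1 ≤ C) (hε : 0 < ε) (hε2 : ε ≤ 1 / 2)
    (h1 : ∀ t, 1 ≤ iterTerm A (H t) (ρ t) k)
    (hbdd : BddAbove (Set.range fun t => iterTerm A (H t) (ρ t) k)) :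
    ∃ T : ℕ, 1 ≤ T ∧ iterBound C Δ A H ρ k ε T ≤ T ∧ (T : ℝ) ≤ 2 * iterBound C Δ A H ρ k ε T := by
  classical
  have hlog := half_le_log_inv hε hε2
  have hp : 0 ≤ Real.posLog Δ := Real.posLog_nonneg
  obtain ⟨K, hK⟩ := hbdd
  have hex : ∃ T : ℕ, 1 ≤ T ∧ iterBound C Δ A H ρ k ε T ≤ T := by
    obtain ⟨T, hT⟩ := exists_nat_ge (C * (1 + Real.posLog Δ) * K * Real.log (1 / ε))
    refine ⟨T + 1, by omega, ?_⟩
    refine le_trans ?_ (hT.trans (by push_cast; linarith))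
    unfold iterBound
    gcongr
    exact ciSup_le fun t => hK ⟨t, rfl⟩
  obtain ⟨hT1, hT2⟩ := Nat.find_spec hex
  refine ⟨Nat.find hex, hT1, hT2, ?_⟩
  obtain ⟨T, hT⟩ : ∃ T, T + 1 = Nat.find hex := ⟨Nat.find hex - 1, by omega⟩
  rw [← hT]
  have hhalf : 1 / 2 ≤ iterBound C Δ A H ρ k ε (T + 1) := by
    have hs : 1 ≤ ⨆ t : Fin (T + 1), iterTerm A (H t) (ρ t) k :=
      (h1 0).trans (le_ciSup (f := fun t : Fin (T + 1) => iterTerm A (H t) (ρ t) k)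
        (Set.finite_range _).bddAbove 0)
    have h3 : 1 ≤ C * (1 + Real.posLog Δ) := one_le_mul_of_one_le_of_one_le hC (by linarith)
    have h4 := one_le_mul_of_one_le_of_one_le h3 hs
    unfold iterBound
    nlinarith
  rcases Nat.eq_zero_or_pos T with h0 | h0
  · subst h0; push_cast; linarith
  · have hmin := Nat.find_min hex (m := T) (by omega)
    have h5 : (T : ℝ) < iterBound C Δ A H ρ k ε T := by
      by_contra! h
      exact hmin ⟨h0, h⟩
    have h6 := iterBound_le_succ (A := A) (H := H) (ρ := ρ) (k := k) (Δ := Δ)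
      (by linarith : 0 ≤ C) hε hε2 h0
    have h7 : (1 : ℝ) ≤ T := by exact_mod_cast h0
    push_cast
    linarith

theorem mul_iterTerm_le_queryTerm (hA : A.PosSemidef) {H : Matrix (Fin d) (Fin d) ℝ} {ρ c : ℝ}
    (hH : H.PosDef) (hρ : 0 < ρ) (hk : 1 ≤ k) (hc : 1 ≤ c) (hl : (l : ℝ) ≤ c * k) :
    l * iterTerm A H ρ k ≤ c * queryTerm A H ρ l := by
  have htr := trace_inv_mul_nonneg hA hH
  have hs := specNorm_nonneg (precond A H)
  have h1 : (l : ℝ) * ((H⁻¹ * A).trace / k) ≤ c * (H⁻¹ * A).trace := by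
    rw [mul_div_assoc', div_le_iff₀ (by linarith)]
    nlinarith
  have h2 : specNorm (precond A H) * l ≤ c * (specNorm (precond A H) * l) :=
    le_mul_of_one_le_left (by positivity) hc
  unfold iterTerm queryTerm
  calc (l : ℝ) * (ρ⁻¹ * (specNorm (precond A H) + (H⁻¹ * A).trace / k))
      = ρ⁻¹ * (specNorm (precond A H) * l + l * ((H⁻¹ * A).trace / k)) := by ring
    _ ≤ ρ⁻¹ * (c * (specNorm (precond A H) * l) + c * (H⁻¹ * A).trace) := by gcongr
    _ = _ := by ring

theorem queries_le_queryBound (hA : A.PosSemidef) (hH : ∀ t, (H t).PosDef) (hρ : ∀ t, 0 < ρ t)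
    (hk : 1 ≤ k) {C Δ ε c₀ : ℝ} {T : ℕ} (hC : 0 ≤ C) (hε : 0 < ε) (hε2 : ε ≤ 1 / 2) (hc₀ : 0 < c₀)
    (hT : 1 ≤ T) (hl : (l : ℝ) ≤ 2 * c₀ * k) (hTN : (T : ℝ) ≤ 2 * iterBound C Δ A H ρ k ε T) :
    ((2 * l * T : ℕ) : ℝ) ≤ queryBound (8 * C * (1 + c₀)) Δ A H ρ l ε T := by
  have hlog := half_le_log_inv hε hε2
  have hp : 0 ≤ Real.posLog Δ := Real.posLog_nonneg
  have : Nonempty (Fin T) := ⟨⟨0, hT⟩⟩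
  have hsup : l * (⨆ t : Fin T, iterTerm A (H t) (ρ t) k)
      ≤ 2 * (1 + c₀) * ⨆ t : Fin T, queryTerm A (H t) (ρ t) l := by
    rw [Real.mul_iSup_of_nonneg (by positivity)]
    refine ciSup_le fun t => ?_
    refine (mul_iterTerm_le_queryTerm hA (hH t) (hρ t) hk (c := 2 * (1 + c₀)) (by linarith)
      (by nlinarith)).trans ?_
    gcongr
    exact le_ciSup (f := fun t : Fin T => queryTerm A (H t) (ρ t) l)
      (Set.finite_range _).bddAbove t
  push_cast
  calc (2 : ℝ) * l * T ≤ 2 * l * (2 * iterBound C Δ A H ρ k ε T) := by gcongr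
    _ = 4 * C * (1 + Real.posLog Δ) * (l * ⨆ t : Fin T, iterTerm A (H t) (ρ t) k)
          * Real.log (1 / ε) := by unfold iterBound; ring
    _ ≤ 4 * C * (1 + Real.posLog Δ) * (2 * (1 + c₀) * ⨆ t : Fin T, queryTerm A (H t) (ρ t) l)
          * Real.log (1 / ε) := by gcongr
    _ = _ := by unfold queryBound; ring

end Complexity

/-! ### The gap along the random iteration -/

section Convergence

variable {d l : ℕ} {φ f : EuclideanSpace ℝ (Fin d) → ℝ} {A : Matrix (Fin d) (Fin d) ℝ}
  {xstar : EuclideanSpace ℝ (Fin d)}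

theorem IsConvexQuadratic.measurable (hφ : IsConvexQuadratic φ A) (hmin : ∀ x, φ xstar ≤ φ x) :
    Measurable φ := by
  have e : φ = fun x => φ xstar
      + 1 / 2 * ((x - xstar).ofLp ⬝ᵥ A.mulVec (x - xstar).ofLp) := by
    funext x; rw [← hφ.sub_min_eq hmin]; ring
  have hc : Continuous fun x : EuclideanSpace ℝ (Fin d) => (x - xstar).ofLp := by fun_prop
  rw [e]
  exact (continuous_const.add (continuous_const.mul
    (hc.dotProduct (continuous_const.matrix_mulVec hc)))).measurable

theorem output_hessianAware_eq_orbit (f : EuclideanSpace ℝ (Fin d) → ℝ) (α : ℝ) (η : ℕ → ℝ)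
    (H : ℕ → Matrix (Fin d) (Fin d) ℝ) (S : ℕ → Matrix (Fin d) (Fin l) ℝ)
    (x₀ : EuclideanSpace ℝ (Fin d)) (t : ℕ) :
    (hessianAware α η H S x₀ t).output f
      = orbit (fun t => step f α (η t) (H t)) x₀ S t := by
  induction t with
  | zero => rfl
  | succ t ih => rw [output_hessianAware_succ, ih, orbit]

/-- At a fixed point, a draw of an oblivious sketching matrix decreases the gap with at least the
probability with which the sketch succeeds. -/
theorem IsObliviousSketch.le_measureReal_step {Ω : Type*} [MeasurableSpace Ω] {P : Measure Ω}
    [IsProbabilityMeasure P] {S : Ω → Matrix (Fin d) (Fin l) ℝ} {H : Matrix (Fin d) (Fin d) ℝ}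
    {k δ σ α ρ : ℝ} (hS : IsObliviousSketch P (1 / 4) k δ S) (hd : 0 < d)
    (hφ : IsConvexQuadratic φ A) (hmin : ∀ x, φ xstar ≤ φ x) (hk : 1 ≤ k) (hα : 0 < α)
    (hρ : 0 < ρ) (hfφ : ∀ x, |f x - φ x| ≤ σ) (hH : H.PosDef) (hAH : (A - ρ • H).PosSemidef)
    (x : EuclideanSpace ℝ (Fin d)) :
    1 - δ ≤ P.real {ω | φ (step f α (stepSize A H k) H x (S ω)) - φ xstar
      ≤ (1 - stepSize A H k * ρ / 4) * (φ x - φ xstar)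
        + stepSize A H k * (l * σ ^ 2 / (2 * α ^ 2))} := by
  obtain ⟨B, hB⟩ := exists_test_matrix (posDef_precond hH hφ.1 hρ hAH)
    (hρ.trans_le (le_specNorm_precond hd hH hAH))
    ((invSqrt H).mulVec (A.mulVec (x - xstar).ofLp)) hk
  refine (hS.2 B).trans (measureReal_mono fun ω hω => ?_)
  obtain ⟨h1, h2⟩ := hB (S ω) hω
  refine hφ.step_gap_le hmin hα (stepSize_rate hd hφ.1 hH hρ hAH hk).1 hρ hfφ hH hAH x (S ω) h1 ?_
  rw [stepSize, inv_inv, ← trace_precond hH]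
  exact h2

end Convergence

end ZerothOrder

open ZerothOrder in
theorem corollary2 :
    ∃ C C' : ℝ, 0 < C ∧ 0 < C' ∧
    ∀ (d l : ℕ) (_ : 0 < d)
      (φ f : EuclideanSpace ℝ (Fin d) → ℝ) (A : Matrix (Fin d) (Fin d) ℝ) (μ σ : ℝ)
      (_ : ZerothOrder.IsConvexQuadratic φ A)
      (_ : 0 < μ) (_ : ZerothOrder.IsStronglyConvex φ μ)
      (_ : Measurable f) (_ : 0 ≤ σ) (_ : ∀ x, |f x - φ x| ≤ σ)
      (xstar : EuclideanSpace ℝ (Fin d)) (_ : ∀ x, φ xstar ≤ φ x)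
      (H : ℕ → Matrix (Fin d) (Fin d) ℝ) (ρ : ℕ → ℝ)
      (_ : ∀ t, (H t).PosDef) (_ : ∀ t, 0 < ρ t) (_ : ∀ t, (A - ρ t • H t).PosSemidef)
      (x₀ : EuclideanSpace ℝ (Fin d)) (α k ε δ c₀ : ℝ)
      (_ : 0 < α) (_ : 1 ≤ k) (_ : 0 < ε) (_ : ε ≤ 1 / 2) (_ : 0 < δ) (_ : δ < 1) (_ : 0 < c₀),
      -- a number of iterations of the claimed order exists
      (BddAbove (Set.range fun t => ZerothOrder.iterTerm A (H t) (ρ t) k) →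
        ∃ T : ℕ, 1 ≤ T ∧
          ZerothOrder.iterBound C (φ x₀ - φ xstar) A H ρ k ε T ≤ T ∧
          (T : ℝ) ≤ 2 * ZerothOrder.iterBound C (φ x₀ - φ xstar) A H ρ k ε T) ∧
      -- every such number of iterations suffices, with the claimed number of queries
      ∀ T : ℕ, 1 ≤ T → Real.log (T / δ) < k → (l : ℝ) ≤ c₀ * (k + Real.log (T / δ)) →
        ZerothOrder.iterBound C (φ x₀ - φ xstar) A H ρ k ε T ≤ T →
        ∀ (Ω : Type*) [MeasurableSpace Ω] (P : MeasureTheory.Measure Ω)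
          [MeasureTheory.IsProbabilityMeasure P]
          (S : ℕ → Ω → Matrix (Fin d) (Fin l) ℝ),
          (∀ t < T, ZerothOrder.IsObliviousSketch P (1 / 4) k (δ / T) (S t)) →
          ProbabilityTheory.iIndepFun (fun (t : Fin T) => S t) P →
          1 - δ ≤ P.real {ω |
              φ ((ZerothOrder.hessianAware α (fun t => ZerothOrder.stepSize A (H t) k) H
                (fun t => S t ω) x₀ T).output f) - φ xstar
              ≤ ε + 3 * l * σ ^ 2 / ((⨅ t : Fin T, ρ t) * α ^ 2)} ∧
          ((T : ℝ) ≤ 2 * ZerothOrder.iterBound C (φ x₀ - φ xstar) A H ρ k ε T →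
            ∀ ω, ((ZerothOrder.hessianAware α (fun t => ZerothOrder.stepSize A (H t) k) H
                (fun t => S t ω) x₀ T).queries f : ℝ)
              ≤ ZerothOrder.queryBound (C' * (1 + c₀)) (φ x₀ - φ xstar) A H ρ l ε T) := by
  refine ⟨40, 8 * 40, by norm_num, by norm_num, ?_⟩
  intro d l hd φ f A μ σ hφ _ _ hf _ hfφ xstar hmin H ρ hH hρ hAH x₀ α k ε δ c₀ hα hk hε hε2
    hδ _ hc₀
  have hterm := fun t => one_le_iterTerm hd hφ.1 (hH t) (hρ t) (hAH t) hk
  refine ⟨exists_iterBound_le (by norm_num) hε hε2 hterm, ?_⟩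
  intro T hT hkT hl hTN Ω _ P _ S hS hind
  refine ⟨?_, fun hT2 ω => ?_⟩
  · have hT0 : Nonempty (Fin T) := ⟨⟨0, hT⟩⟩
    let η : ℕ → ℝ := fun t => stepSize A (H t) k
    let F : ℕ → EuclideanSpace ℝ (Fin d) → Matrix (Fin d) (Fin l) ℝ → EuclideanSpace ℝ (Fin d) :=
      fun t => step f α (η t) (H t)
    let G : ℕ → Set (EuclideanSpace ℝ (Fin d) × Matrix (Fin d) (Fin l) ℝ) := fun t =>
      {p | φ (F t p.1 p.2) - φ xstar
        ≤ (1 - η t * ρ t / 4) * (φ p.1 - φ xstar) + η t * (l * σ ^ 2 / (2 * α ^ 2))}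
    have hF : ∀ t, Measurable fun p : EuclideanSpace ℝ (Fin d) × Matrix (Fin d) (Fin l) ℝ =>
        F t p.1 p.2 := fun t => measurable_step hf α (η t) (H t)
    have hφm := hφ.measurable hmin
    have hG : ∀ t, MeasurableSet (G t) := fun t =>
      measurableSet_le ((hφm.comp (hF t)).sub_const _)
        ((((hφm.comp measurable_fst).sub_const _).const_mul _).add_const _)
    refine (one_sub_le_measureReal_orbit hF x₀ hT (fun t ht => (hS t ht).1) hind hG hδ.le
      fun t ht x => (hS t ht).le_measureReal_step hd hφ hmin hk hα (hρ t) hfφ (hH t) (hAH t)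
        x).trans (measureReal_mono fun ω hω => ?_)
    rw [Set.mem_ofPred_eq, output_hessianAware_eq_orbit]
    obtain ⟨I, hI⟩ : ∃ I, I = ⨆ t : Fin T, iterTerm A (H t) (ρ t) k := ⟨_, rfl⟩
    have hIt : ∀ t < T, iterTerm A (H t) (ρ t) k ≤ I := fun t ht => by
      rw [hI]
      exact le_ciSup (f := fun t : Fin T => iterTerm A (H t) (ρ t) k)
        (Set.finite_range _).bddAbove ⟨t, ht⟩
    have hI1 : 1 ≤ I := (hterm 0).trans (hIt 0 hT)
    obtain ⟨r, hr⟩ : ∃ r, r = ⨅ t : Fin T, ρ t := ⟨_, rfl⟩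
    have hr0 : 0 < r := by
      obtain ⟨i, hi⟩ := exists_eq_ciInf_of_finite (f := fun t : Fin T => ρ t)
      rw [hr, ← hi]
      exact hρ i
    have hrt : ∀ t < T, r ≤ ρ t := fun t ht => by
      rw [hr]
      exact ciInf_le (f := fun t : Fin T => ρ t) (Set.finite_range _).bddBelow ⟨t, ht⟩
    have ha : (20 * I)⁻¹ ≤ 1 := inv_le_one_of_one_le₀ (by linarith)
    -- noise enters step `t` with weight `η_t`, i.e. it holds the gap at `2 l σ² / (ρ_t α²)`
    have hmain := le_pow_mul_add_of_contraction
      (e := fun t => φ (orbit F x₀ (fun t => S t ω) t) - φ xstar)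
      (b := fun t => η t * ρ t / 4) (a := (20 * I)⁻¹) (R := 2 * l * σ ^ 2 / (r * α ^ 2)) (T := T)
      (sub_nonneg.2 (hmin _)) ha
      (fun t ht => by
        obtain ⟨_, h1, h2⟩ := stepSize_rate hd hφ.1 (hH t) (hρ t) (hAH t) hk
        refine ⟨le_trans ?_ h1, h2⟩
        have h3 := hterm t
        have h4 := hIt t ht
        gcongr)
      (fun t ht => by
        refine (hω t ht).trans ?_
        have h0 : 0 < η t := (stepSize_rate hd hφ.1 (hH t) (hρ t) (hAH t) hk).1
        have h1 : η t * (l * σ ^ 2 / (2 * α ^ 2))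
            ≤ η t * ρ t / 4 * (2 * l * σ ^ 2 / (r * α ^ 2)) := by
          have h2 : 1 ≤ ρ t / r := by rw [le_div_iff₀ hr0]; linarith [hrt t ht]
          have e : η t * ρ t / 4 * (2 * l * σ ^ 2 / (r * α ^ 2))
              = η t * (l * σ ^ 2 / (2 * α ^ 2)) * (ρ t / r) := by field_simp; ring
          rw [e]
          exact le_mul_of_one_le_right (by positivity) h2
        gcongr)
      (by positivity)
    refine hmain.trans (add_le_add ?_ ?_)
    · refine pow_mul_le_of_le ha (sub_nonneg.2 (hmin _)) hε hε2 ?_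
      rw [iterBound, ← hI] at hTN
      rw [inv_mul_eq_div, le_div_iff₀ (by positivity)]
      refine le_trans (le_of_eq ?_) hTN
      simp only [orbit]
      ring
    · rw [← hr]
      gcongr
      norm_num
  · rw [queries_hessianAware]
    exact queries_le_queryBound hφ.1 hH hρ hk (by norm_num) hε hε2 hc₀ hT
      (by nlinarith) hT2
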